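/- Let $ABC$ be a nondegenerate triangle and let $\Gamma$ be a circle that meets the lines $BC$, $CA$, $AB$ in the pairs of distinct points $\{A_1,A_2\}$, $\{B_1,B_2\}$, $\{C_1,C_2\}$ respectively, where $A_1B_1C_1$ and $A_2B_2C_2$ are nondegenerate triangles. (If a vertex of $ABC$ lies on $\Gamma$, a circle $AEF$ below with $F=A$ is the circle through $E$ tangent to $AB$ at $A$, and similarly in the other cases; a line joining two coinciding points of $\Gamma$ is the tangent there.) Let $P$ be the Miquel point of $A_1B_1C_1$ in $ABC$, i.e. the common point of the circles $AB_1C_1$, $BC_1A_1$, $CA_1B_1$, and let $Q$ be the Miquel point of $A_2B_2C_2$ in $ABC$. Put $$T_A=PA_1\cap QA_2,\quad T_B=PB_1\cap QB_2,\quad T_C=PC_1\cap QC_2$$ (the generalized first Brocard triangle), and assume that these points exist and form a nondegenerate triangle. Let $A'$ be the second common point (besides $A$) of the circles $AB_1C_1$ and $AB_2C_2$, let $B'$ be that (besides $B$) of the circles $BC_1A_1$ and $BC_2A_2$, and let $C'$ be that (besides $C$) of the circles $CA_1B_1$ and $CA_2B_2$ (the generalized second Brocard triangle); if two such circles touch,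 the second common point is the point of contact. Then $T_AT_BT_C$ and $A'B'C'$ are perspective: the lines $T_AA'$, $T_BB'$, $T_CC'$ pass through a common point, possibly at infinity (a pair of coinciding corresponding vertices imposes no condition). Moreover, there is an inverse (orientation-reversing) similarity $f$ of the plane with $f(A)=T_A$, $f(B)=T_B$, $f(C)=T_C$, and the following holds. Let $R$ be the pole with respect to $\Gamma$ of the line through the points $$A_0=B_1C_2\cap C_1B_2,\quad B_0=A_1C_2\cap C_1A_2,\quad C_0=A_1B_2\cap B_1A_2$$ (one of which may be at infinity). If $R$ lies on none of the lines $BC,CA,AB$ and has an isogonal conjugate $R^*$ in $ABC$ (in the finite plane), then $S=f(R^*)$ is a perspector: it lies on $T_AA'$, $T_BB'$ and $T_CC'$. -/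

import Mathlib

/-! The Euclidean plane is `ℂ`, with its standard metric, inner product and orientation. -/

namespace GenBrocard

open EuclideanGeometry

attribute [local instance] Complex.finrank_real_complex_fact

/-- For `E` on line `AC` and `F` on line `AB`: `s` is the circle `AEF`, that is, `s` meets line
`AC` exactly in `A` and `E`, and line `AB` exactly in `A` and `F`.  If `E ≠ A` and `F ≠ A` this is
the circle through the three points `A, E, F`.  If `F = A` it is the circle through `A` and `E`
tangent to line `AB` at `A` (the usual reading in the case of the Brocard points), and
symmetrically if `E = A`. -/
def IsCornerCircle (A B C E F : ℂ) (s : Sphere ℂ) : Prop :=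
  (s : Set ℂ) ∩ (line[ℝ, A, C] : Set ℂ) = {A, E} ∧
  (s : Set ℂ) ∩ (line[ℝ, A, B] : Set ℂ) = {A, F}

/-- `M` is the Miquel point in triangle `ABC` of the inscribed triangle `DEF`
(`D` on `BC`, `E` on `CA`, `F` on `AB`): a common point of the circles `AEF`, `BFD`, `CDE`. -/
def IsMiquelPoint (A B C D E F M : ℂ) : Prop :=
  ∃ s t u : Sphere ℂ,
    IsCornerCircle A B C E F s ∧ IsCornerCircle B C A F D t ∧ IsCornerCircle C A B D E u ∧
    M ∈ s ∧ M ∈ t ∧ M ∈ u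

/-- `X` is the second common point, besides `A`, of the circles `A E₁ F₁` and `A E₂ F₂`
(`E₁, E₂` on `AC` and `F₁, F₂` on `AB`); it is `A` itself if the circles touch at `A`. -/
def IsSecondCommonPoint (A B C E₁ F₁ E₂ F₂ X : ℂ) : Prop :=
  ∃ s t : Sphere ℂ,
    IsCornerCircle A B C E₁ F₁ s ∧ IsCornerCircle A B C E₂ F₂ t ∧
    (s : Set ℂ) ∩ (t : Set ℂ) = {A, X}

open Classical in
/-- The line `XY` through two points of the circle `Γ`; the tangent at `X` if `X = Y`. -/
noncomputable def chordLine (Γ : Sphere ℂ) (X Y : ℂ) : AffineSubspace ℝ ℂ :=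
  if X = Y then Γ.orthRadius X else line[ℝ, X, Y]

/-- `R` lies on the polar, with respect to `Γ`, of the common point of the two lines `l` and `m`.
The polar of a point `X` is `{Y | ⟪X - O, Y - O⟫ = r²}`.  If `l` and `m` are parallel, their
common point is at infinity, and its polar is the diameter of `Γ` perpendicular to them. -/
def OnPolarOfMeet (Γ : Sphere ℂ) (l m : AffineSubspace ℝ ℂ) (R : ℂ) : Prop :=
  (∀ X : ℂ, X ∈ l → X ∈ m → inner ℝ (X - Γ.center) (R - Γ.center) = Γ.radius ^ 2) ∧
  (l.Parallel m → ∀ v ∈ l.direction, inner ℝ v (R - Γ.center) = 0)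

/-- `R` is the pole with respect to `Γ` of the line through the three points
`A₀ = B₁C₂ ∩ C₁B₂`, `B₀ = A₁C₂ ∩ C₁A₂`, `C₀ = A₁B₂ ∩ B₁A₂`
(collinear by Pascal's theorem), i.e. `R` lies on the polars of these points. -/
def IsPoleOfPascalLine (Γ : Sphere ℂ) (A₁ A₂ B₁ B₂ C₁ C₂ R : ℂ) : Prop :=
  OnPolarOfMeet Γ (chordLine Γ B₁ C₂) (chordLine Γ C₁ B₂) R ∧
  OnPolarOfMeet Γ (chordLine Γ A₁ C₂) (chordLine Γ C₁ A₂) R ∧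
  OnPolarOfMeet Γ (chordLine Γ A₁ B₂) (chordLine Γ B₁ A₂) R

/-- Equality `∡ X Y Z = ∡ X' Y' Z'` of directed angles modulo `π`. -/
def DirAngleEq (X Y Z X' Y' Z' : ℂ) : Prop :=
  (2 : ℤ) • Complex.orientation.oangle (X - Y) (Z - Y) =
    (2 : ℤ) • Complex.orientation.oangle (X' - Y') (Z' - Y')

/-- `R` lies on none of the side lines of triangle `ABC`, and `R'` is its isogonal conjugate:
at each vertex, the lines to `R` and `R'` are mirror images in the bisector of the angle. -/
def IsIsogonalConjugate (A B C R R' : ℂ) : Prop :=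
  R ∉ line[ℝ, B, C] ∧ R ∉ line[ℝ, C, A] ∧ R ∉ line[ℝ, A, B] ∧
  DirAngleEq B A R R' A C ∧ DirAngleEq C B R R' B A ∧ DirAngleEq A C R R' C B

/-- `f` is an inverse (orientation-reversing) similarity of the plane. -/
def IsInverseSimilarity (f : ℂ → ℂ) : Prop :=
  ∃ a b : ℂ, a ≠ 0 ∧ ∀ z, f z = a * (starRingEnd ℂ) z + b

/-- `S` lies on the lines `XX'`, `YY'`, `ZZ'` joining corresponding vertices
(no condition from a vertex that coincides with the corresponding one). -/
def IsPerspector (X Y Z X' Y' Z' S : ℂ) : Prop :=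
  Collinear ℝ {X, X', S} ∧ Collinear ℝ {Y, Y', S} ∧ Collinear ℝ {Z, Z', S}

/-- The triangles `XYZ` and `X'Y'Z'` are perspective: the lines joining corresponding vertices
meet in a point of the plane, or in a point at infinity (all have the direction `v`). -/
def ArePerspective (X Y Z X' Y' Z' : ℂ) : Prop :=
  (∃ S, IsPerspector X Y Z X' Y' Z' S) ∨
  (∃ v : ℂ, v ≠ 0 ∧ ∃ p q r : ℝ, X' - X = p • v ∧ Y' - Y = q • v ∧ Z' - Z = r • v)

end GenBrocard

namespace GenBrocard

open EuclideanGeometry ComplexConjugate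

/-! Scale Γ to the unit circle, with centre O = 0. The sides become z + p z̄ = a₁ + a₂, and likewise
with q, r, where p = a₁a₂, q = b₁b₂, r = c₁c₂ are unimodular and record the directions of the sides.
The Miquel property says that PA₁, PB₁, PC₁ make equal directed angles with the sides; that angle is
encoded by one unimodular τ (`exists_common_ratio`), and Q has the inverse ratio
(`ratio_relations`).

Define R by (1 − τ)R = 2P. Then T_A = (R + pR̄)/2 is the foot of the perpendicular from R to the
line through O orthogonal to BC (`two_mul_brocard_vertex`), and A' = (R + κR̄)/2 is the foot of the
perpendicular from O to AR, where κ records the direction of AR (`exists_reflection_coeff`). So both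
triangles are inscribed in the circle with diameter OR. The map t ↦ (R + tR̄)/2 carries the unit
circle onto it, and perspectivity becomes concurrency of the chords pκ, qμ, rν of the unit circle.

The triangle pqr is inversely similar to ABC (`triangle_relations`). If g is the image of R, the
chord pκ is isogonal to the line pg at p; in general the three chords therefore meet in the isogonal
conjugate of g, or are parallel when g is on the circle (`isogonal_chords_det`). Composing the two
similarities gives f, and f(R*) is the perspector (`isogonal_collinear`). Finally AR, BR, CR are the
polars of A₀, B₀, C₀, so R is the pole in the statement (`eq_of_reflection_coeff`). -/

theorem conj_ne_zero {z : ℂ} (h : z ≠ 0) : conj z ≠ 0 :=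
  (map_ne_zero _).2 h

theorem mem_line_iff (x y z : ℂ) : z ∈ line[ℝ, x, y] ↔ ∃ t : ℝ, z = x + t * (y - x) := by
  constructor
  · intro h
    obtain ⟨t, rfl⟩ := mem_affineSpan_pair_iff_exists_lineMap_eq.1 h
    exact ⟨t, by simp [AffineMap.lineMap_apply, add_comm]⟩
  · rintro ⟨t, rfl⟩
    refine mem_affineSpan_pair_iff_exists_lineMap_eq.2 ⟨t, ?_⟩
    simp [AffineMap.lineMap_apply, add_comm]

theorem normSq_of_mem {s : Sphere ℂ} {z : ℂ} (h : z ∈ s) :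
    (z - s.center) * conj (z - s.center) = (s.radius : ℂ) ^ 2 := by
  rw [mem_sphere, dist_eq_norm] at h
  rw [Complex.mul_conj, Complex.normSq_eq_norm_sq, h]
  push_cast; rfl

theorem mem_of_normSq_eq {s : Sphere ℂ} {z A : ℂ} (hA : A ∈ s)
    (h : (z - s.center) * conj (z - s.center) = (A - s.center) * conj (A - s.center)) :
    z ∈ s := by
  rw [mem_sphere, dist_eq_norm] at *
  rw [Complex.mul_conj, Complex.mul_conj, Complex.normSq_eq_norm_sq,
    Complex.normSq_eq_norm_sq] at h
  have h' : ‖z - s.center‖ ^ 2 = ‖A - s.center‖ ^ 2 := by exact_mod_cast h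
  rw [← hA]
  exact (sq_eq_sq₀ (norm_nonneg _) (norm_nonneg _)).1 h'

theorem collinear_of_mul_conj_eq {x y z : ℂ}
    (h : (y - x) * conj (z - x) = conj (y - x) * (z - x)) : Collinear ℝ {x, y, z} := by
  by_cases hxy : y = x
  · subst hxy
    simpa using collinear_pair ℝ y z
  have hyx : y - x ≠ 0 := sub_ne_zero.2 hxy
  have hc : conj (y - x) ≠ 0 := conj_ne_zero hyx
  obtain ⟨t, ht⟩ := (Complex.conj_eq_iff_real (z := (z - x) / (y - x))).1 (by
    rw [map_div₀, div_eq_div_iff hc hyx]; linear_combination h)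
  rw [div_eq_iff hyx] at ht
  rw [collinear_iff_of_mem (p₀ := x) (by simp)]
  refine ⟨y - x, ?_⟩
  simp only [Set.mem_insert_iff, Set.mem_singleton_iff, forall_eq_or_imp, forall_eq]
  refine ⟨⟨0, by simp⟩, ⟨1, by simp⟩, ⟨t, ?_⟩⟩
  simp only [Complex.real_smul, vadd_eq_add]
  linear_combination ht

theorem mul_conj_ne_of_affineIndependent {x y z : ℂ} (h : AffineIndependent ℝ ![x, y, z]) :
    (y - x) * conj (z - x) ≠ conj (y - x) * (z - x) := fun h' =>
  affineIndependent_iff_not_collinear_set.1 h (collinear_of_mul_conj_eq h')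

/-! ### Circles through a vertex -/

/-- The centre of a circle through `A` whose second point on the line `AC` is `E`; the direction
of this line is recorded by `p`. -/
theorem center_of_inter_line {A C E p : ℂ} {s : Sphere ℂ} (hAC : C - A ≠ 0)
    (hp : C - A = -p * conj (C - A)) (h : (s : Set ℂ) ∩ (line[ℝ, A, C] : Set ℂ) = {A, E}) :
    A ∈ s ∧ E - A = -p * conj (E - A) ∧
      (s.center - A) - p * conj (s.center - A) = E - A := by
  have hA : A ∈ (s : Set ℂ) ∩ (line[ℝ, A, C] : Set ℂ) := by rw [h]; simp
  have hE : E ∈ (s : Set ℂ) ∩ (line[ℝ, A, C] : Set ℂ) := by rw [h]; simp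
  have hAs : A ∈ s := hA.1
  have hEs : E ∈ s := hE.1
  obtain ⟨e, he⟩ := (mem_line_iff _ _ _).1 hE.2
  have hu : conj (C - A) ≠ 0 := conj_ne_zero hAC
  set u := C - A with hu_def
  set y := s.center - A with hy
  have hyc : s.center = A + y := by rw [hy]; ring
  -- `t * u` is twice the projection of `y` to the line, so `A + t * u` is the reflection of `A` in
  -- the foot of the centre and lies on the circle again.
  obtain ⟨t, ht⟩ := (Complex.conj_eq_iff_real
      (z := (y * conj u + conj y * u) / (u * conj u))).1 (by
    simp only [map_div₀, map_add, map_mul, Complex.conj_conj]; ring)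
  rw [div_eq_iff (mul_ne_zero hAC hu)] at ht
  have ht2 : y - p * conj y = t * u := by
    apply mul_right_cancel₀ hu
    linear_combination ht - conj y * hp
  refine ⟨hAs, ?_, ?_⟩
  · rw [he]
    simp only [map_sub, map_add, map_mul, Complex.conj_ofReal] at hp ⊢
    linear_combination (e : ℂ) * hp
  have hmem : A + t * u ∈ (s : Set ℂ) ∩ (line[ℝ, A, C] : Set ℂ) := by
    refine ⟨mem_of_normSq_eq hAs ?_, (mem_line_iff _ _ _).2 ⟨t, rfl⟩⟩
    rw [hyc]
    simp only [map_sub, map_add, map_mul, Complex.conj_ofReal]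
    linear_combination -(t : ℂ) * ht
  rw [h] at hmem
  rw [ht2]
  rcases hmem with h0 | h0
  -- Tangent case: the line meets the circle only at `A`, which forces `E = A`.
  · have h1 : (t : ℂ) * u = 0 := by linear_combination h0
    have h2 : (t : ℂ) = 0 := (mul_eq_zero.1 h1).resolve_right hAC
    have h3 := (normSq_of_mem hEs).trans (normSq_of_mem hAs).symm
    rw [he, hyc] at h3
    simp only [map_sub, map_add, map_mul, Complex.conj_ofReal] at h3
    have h4 : (e : ℂ) * (e * (u * conj u)) = 0 := by
      rw [h2] at ht
      linear_combination h3 + (e : ℂ) * ht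
    have h5 : (e : ℂ) = 0 := by
      rcases mul_eq_zero.1 h4 with h | h
      · exact h
      · exact (mul_eq_zero.1 h).resolve_right (mul_ne_zero hAC hu)
    rw [he, h1, h5]; ring
  · rw [Set.mem_singleton_iff] at h0
    rw [← h0]; ring

/-- A point `M` of the circle `AEF` sees the sides at `E` and `F` under equal directed angles. -/
theorem IsCornerCircle.angle_eq {A B C E F M p q : ℂ} {s : Sphere ℂ}
    (h : IsCornerCircle A B C E F s) (hM : M ∈ s) (hC : C - A ≠ 0) (hB : B - A ≠ 0)
    (hp : C - A = -p * conj (C - A)) (hq : B - A = -q * conj (B - A)) :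
    (M - E) * (q * conj (M - F)) = (M - F) * (p * conj (M - E)) := by
  obtain ⟨hA, hE, hyE⟩ := center_of_inter_line hC hp h.1
  obtain ⟨-, hF, hyF⟩ := center_of_inter_line hB hq h.2
  have h1 := (normSq_of_mem hM).trans (normSq_of_mem hA).symm
  simp only [map_sub] at *
  linear_combination (q - p) * h1 - (M - E) * hF + (M - F) * hE +
    (conj M - conj A) * (q * hyE - p * hyF) + (M - A) * (hyE - hyF)

/-- The relation rearranges to (E₁ − X)(F₂ − X) = (E₂ − X)(F₁ − X): `X` is the centre of the spiral
similarity taking E₁, F₁ to E₂, F₂. -/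
theorem IsSecondCommonPoint.eq {A B C E₁ F₁ E₂ F₂ X p q : ℂ}
    (h : IsSecondCommonPoint A B C E₁ F₁ E₂ F₂ X) (hC : C - A ≠ 0) (hB : B - A ≠ 0)
    (hp : C - A = -p * conj (C - A)) (hq : B - A = -q * conj (B - A)) (hpq : p ≠ q)
    (hE : E₁ ≠ E₂) :
    (X - A) * (E₁ - F₁ - E₂ + F₂) = (E₁ - A) * (F₂ - A) - (E₂ - A) * (F₁ - A) := by
  obtain ⟨s, t, hs, ht, hst⟩ := h
  obtain ⟨hAs, -, hs1⟩ := center_of_inter_line hC hp hs.1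
  obtain ⟨-, -, hs2⟩ := center_of_inter_line hB hq hs.2
  obtain ⟨hAt, -, ht1⟩ := center_of_inter_line hC hp ht.1
  obtain ⟨-, -, ht2⟩ := center_of_inter_line hB hq ht.2
  have hX : X ∈ (s : Set ℂ) ∩ (t : Set ℂ) := by rw [hst]; simp
  have hXs := (normSq_of_mem hX.1).trans (normSq_of_mem hAs).symm
  have hXt := (normSq_of_mem hX.2).trans (normSq_of_mem hAt).symm
  set y := s.center - A with hy
  set z := t.center - A with hz
  have hyc : s.center = A + y := by rw [hy]; ring
  have hzc : t.center = A + z := by rw [hz]; ring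
  have hd : y - z ≠ 0 := by
    intro h0
    have : y = z := sub_eq_zero.1 h0
    rw [this] at hs1
    exact hE (by linear_combination ht1 - hs1)
  have hd'' : conj y - conj z ≠ 0 := by simpa only [map_sub] using conj_ne_zero hd
  clear_value y z
  -- `A + x` is the reflection of `A` in the line of centres.
  set x := (conj y * z - y * conj z) / conj (y - z) with hx
  have hxm : x * (conj y - conj z) = conj y * z - y * conj z := by
    rw [hx, map_sub, div_mul_cancel₀ _ hd'']
  have hxc : conj x * (y - z) = y * conj z - conj y * z := by
    have := congrArg conj hxm
    simpa only [map_sub, map_mul, Complex.conj_conj] using this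
  have hmem : A + x ∈ (s : Set ℂ) ∩ (t : Set ℂ) := by
    constructor
    · refine mem_of_normSq_eq hAs ?_
      rw [hyc]
      simp only [map_sub, map_add]
      apply mul_right_cancel₀ (mul_ne_zero hd hd'')
      linear_combination (conj x * (y - z) - conj y * (y - z)) * hxm +
        (conj y * z - y * conj z - y * (conj y - conj z)) * hxc
    · refine mem_of_normSq_eq hAt ?_
      rw [hzc]
      simp only [map_sub, map_add]
      apply mul_right_cancel₀ (mul_ne_zero hd hd'')
      linear_combination (conj x * (y - z) - conj z * (y - z)) * hxm +
        (conj y * z - y * conj z - z * (conj y - conj z)) * hxc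
  have hXx : X - A = x := by
    rw [hst] at hmem
    rcases hmem with h0 | h0
    -- Touching circles: the centres are collinear with `A`, and a common point other than `A` would
    -- make them equal.
    · have hx0 : x = 0 := by linear_combination h0
      rw [hx0] at hxm
      rw [hx0]
      by_contra hne
      have hne' : conj (X - A) ≠ 0 := conj_ne_zero hne
      rw [hyc] at hXs
      rw [hzc] at hXt
      simp only [map_sub, map_add] at hXs hXt hne'
      have h1 : (X - A) * conj y + (conj X - conj A) * y = (X - A) * (conj X - conj A) := by
        linear_combination -hXs
      have h2 : (X - A) * conj z + (conj X - conj A) * z = (X - A) * (conj X - conj A) := by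
        linear_combination -hXt
      have h3 : (X - A) * (conj X - conj A) * (y - z) = 0 := by
        linear_combination (X - A) * hxm - y * h2 + z * h1
      exact mul_ne_zero (mul_ne_zero hne hne') hd h3
    · rw [Set.mem_singleton_iff] at h0
      rw [← h0]; ring
  rw [hXx]
  have hqp : q - p ≠ 0 := sub_ne_zero.2 hpq.symm
  apply mul_right_cancel₀ hqp
  rw [← hs1, ← ht1]
  have hF1 : F₁ = A + (y - q * conj y) := by rw [hs2]; ring
  have hF2 : F₂ = A + (z - q * conj z) := by rw [ht2]; ring
  have hE1 : E₁ = A + (y - p * conj y) := by rw [hs1]; ring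
  have hE2 : E₂ = A + (z - p * conj z) := by rw [ht1]; ring
  rw [hF1, hF2, hE1, hE2]
  linear_combination (q - p) ^ 2 * hxm

/-! ### Chords, polars and directed angles -/

theorem ofReal_inner (w z : ℂ) :
    ((inner ℝ w z : ℝ) : ℂ) = (z * conj w + conj z * w) / 2 := by
  rw [Complex.inner, Complex.re_eq_add_conj]
  simp

theorem mem_chordLine_iff {Γ : Sphere ℂ} (hr : (Γ.radius : ℂ) ≠ 0) {x y : ℂ}
    (hx : x * conj x = 1) (hy : y * conj y = 1) (z : ℂ) :
    Γ.center + Γ.radius * z ∈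
        chordLine Γ (Γ.center + Γ.radius * x) (Γ.center + Γ.radius * y) ↔
      z + x * y * conj z = x + y := by
  unfold chordLine
  split_ifs with hxy
  · have hxy' : x = y := mul_left_cancel₀ hr (add_left_cancel hxy)
    subst hxy'
    have hx0 : x ≠ 0 := left_ne_zero_of_mul_eq_one hx
    rw [Sphere.mem_orthRadius_iff_inner_left, ← Complex.ofReal_inj, ofReal_inner]
    simp only [vsub_eq_sub, map_sub, map_add, map_mul, Complex.conj_ofReal, Complex.ofReal_zero]
    constructor
    · intro h
      apply mul_left_cancel₀ (mul_ne_zero hr hr)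
      linear_combination 2 * x * h - (Γ.radius : ℂ) ^ 2 * (z - 2 * x) * hx
    · intro h
      apply mul_left_cancel₀ hx0
      linear_combination (Γ.radius : ℂ) ^ 2 / 2 * (h + (z - 2 * x) * hx)
  · have hxy' : x ≠ y := fun h => hxy (by rw [h])
    have hyx : y - x ≠ 0 := sub_ne_zero.2 hxy'.symm
    rw [mem_line_iff]
    constructor
    · rintro ⟨t, ht⟩
      have hz : z = x + t * (y - x) := by
        apply mul_left_cancel₀ hr
        linear_combination ht
      rw [hz]
      simp only [map_sub, map_add, map_mul, Complex.conj_ofReal]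
      linear_combination (y - t * y) * hx + t * x * hy
    · intro h
      obtain ⟨t, ht⟩ := (Complex.conj_eq_iff_real (z := (z - x) / (y - x))).1 (by
        rw [map_div₀, div_eq_div_iff (conj_ne_zero hyx) hyx]
        simp only [map_sub]
        linear_combination (conj x - conj y) * h + (x * conj z - 1) * hy -
          (y * conj z - 1) * hx)
      rw [div_eq_iff hyx] at ht
      exact ⟨t, by linear_combination (Γ.radius : ℂ) * ht⟩

theorem mem_direction_chordLine_iff {Γ : Sphere ℂ} (hr : (Γ.radius : ℂ) ≠ 0) {x y : ℂ}
    (hx : x * conj x = 1) (hy : y * conj y = 1) (v : ℂ) :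
    v ∈ (chordLine Γ (Γ.center + Γ.radius * x) (Γ.center + Γ.radius * y)).direction ↔
      v + x * y * conj v = 0 := by
  have hmem := (mem_chordLine_iff hr hx hy x).2 (by linear_combination y * hx)
  rw [← AffineSubspace.vadd_mem_iff_mem_direction v hmem]
  have hv : v +ᵥ (Γ.center + Γ.radius * x) = Γ.center + Γ.radius * (x + v / Γ.radius) := by
    rw [vadd_eq_add]; field_simp; ring
  rw [hv, mem_chordLine_iff hr hx hy]
  simp only [map_add, map_div₀, Complex.conj_ofReal]
  constructor
  · intro h
    field_simp at h
    linear_combination h - y * (Γ.radius : ℂ) * hx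
  · intro h
    field_simp
    linear_combination h + y * (Γ.radius : ℂ) * hx

/-- The polar, with respect to the unit circle, of the meet of the chords `xy` and `zw`. -/
theorem OnPolarOfMeet.eq {Γ : Sphere ℂ} (hr : (Γ.radius : ℂ) ≠ 0) {x y z w R : ℂ}
    (hx : x * conj x = 1) (hy : y * conj y = 1) (hz : z * conj z = 1) (hw : w * conj w = 1)
    (h : OnPolarOfMeet Γ (chordLine Γ (Γ.center + Γ.radius * x) (Γ.center + Γ.radius * y))
      (chordLine Γ (Γ.center + Γ.radius * z) (Γ.center + Γ.radius * w))
      (Γ.center + Γ.radius * R)) :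
    (x + y - z - w) * R + (x * y * (z + w) - z * w * (x + y)) * conj R =
      2 * (x * y - z * w) := by
  have hx0 : x ≠ 0 := left_ne_zero_of_mul_eq_one hx
  have hy0 : y ≠ 0 := left_ne_zero_of_mul_eq_one hy
  have hz0 : z ≠ 0 := left_ne_zero_of_mul_eq_one hz
  have hw0 : w ≠ 0 := left_ne_zero_of_mul_eq_one hw
  have hx' : conj x = x⁻¹ := eq_inv_of_mul_eq_one_right hx
  have hy' : conj y = y⁻¹ := eq_inv_of_mul_eq_one_right hy
  have hz' : conj z = z⁻¹ := eq_inv_of_mul_eq_one_right hz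
  have hw' : conj w = w⁻¹ := eq_inv_of_mul_eq_one_right hw
  -- Equality of the products means that the chords are parallel; the pole is then tested against a
  -- direction vector only.
  by_cases hd : x * y - z * w = 0
  · have hzw : z * w = x * y := by linear_combination -hd
    have hpar : (chordLine Γ (Γ.center + Γ.radius * x) (Γ.center + Γ.radius * y)).Parallel
        (chordLine Γ (Γ.center + Γ.radius * z) (Γ.center + Γ.radius * w)) := by
      rw [AffineSubspace.parallel_iff_direction_eq_and_eq_bot_iff_eq_bot]
      constructor
      · ext v
        rw [mem_direction_chordLine_iff hr hx hy, mem_direction_chordLine_iff hr hz hw, hzw]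
      · have h1 := (mem_chordLine_iff hr hx hy x).2 (by linear_combination y * hx)
        have h2 := (mem_chordLine_iff hr hz hw z).2 (by linear_combination w * hz)
        constructor
        · intro h0; rw [h0] at h1; exact absurd h1 (AffineSubspace.notMem_bot _ _ _)
        · intro h0; rw [h0] at h2; exact absurd h2 (AffineSubspace.notMem_bot _ _ _)
    have hR : ∀ v : ℂ, v ≠ 0 → v + x * y * conj v = 0 → R = x * y * conj R := by
      intro v hv hv'
      have h1 := h.2 hpar v ((mem_direction_chordLine_iff hr hx hy v).2 hv')
      rw [← Complex.ofReal_inj, ofReal_inner] at h1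
      simp only [map_sub, map_add, map_mul, Complex.conj_ofReal, Complex.ofReal_zero] at h1
      apply mul_left_cancel₀ (mul_ne_zero hr (conj_ne_zero hv))
      linear_combination 2 * h1 - Γ.radius * conj R * hv'
    have hR' : R = x * y * conj R := by
      -- The direction vector is `I * x` for a tangent and `x - y` for a proper chord.
      by_cases hxy : x = y
      · subst hxy
        refine hR (Complex.I * x) (mul_ne_zero Complex.I_ne_zero hx0) ?_
        rw [map_mul, Complex.conj_I]
        linear_combination -Complex.I * x * hx
      · refine hR (x - y) (sub_ne_zero.2 hxy) ?_
        rw [map_sub]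
        linear_combination y * hx - x * hy
    linear_combination (x + y - z - w) * hR' + (conj R * (x + y) - 2) * hd
  · have hd' : conj (x * y - z * w) ≠ 0 := conj_ne_zero hd
    -- The meet of the chords, from solving their two equations for `X` and `conj X`.
    set X := (x * y * (z + w) - z * w * (x + y)) / (x * y - z * w) with hX
    have hXm : X * (x * y - z * w) = x * y * (z + w) - z * w * (x + y) := div_mul_cancel₀ _ hd
    have hXc : conj X * (x * y - z * w) = x + y - z - w := by
      have h1 := congrArg conj hXm
      simp only [map_sub, map_add, map_mul, hx', hy', hz', hw'] at h1
      field_simp at h1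
      linear_combination -h1
    have h1 := h.1 (Γ.center + Γ.radius * X)
      ((mem_chordLine_iff hr hx hy X).2 (by
        apply mul_right_cancel₀ hd
        linear_combination hXm + x * y * hXc))
      ((mem_chordLine_iff hr hz hw X).2 (by
        apply mul_right_cancel₀ hd
        linear_combination hXm + z * w * hXc))
    rw [← Complex.ofReal_inj, ofReal_inner] at h1
    simp only [map_sub, map_add, map_mul, Complex.conj_ofReal, Complex.ofReal_pow] at h1
    apply mul_left_cancel₀ (mul_ne_zero hr hr)
    linear_combination 2 * (x * y - z * w) * h1 - Γ.radius ^ 2 * (conj R * hXm + R * hXc)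

theorem mul_conj_eq_of_two_zsmul_arg_eq {x y : ℂ}
    (h : (2 : ℤ) • (Complex.arg x : Real.Angle) = (2 : ℤ) • (Complex.arg y : Real.Angle)) :
    x * conj y = conj x * y := by
  by_cases hx : x = 0
  · simp [hx]
  by_cases hy : y = 0
  · simp [hy]
  have h1 : (2 : ℤ) • ((Complex.arg (x / y) : ℝ) : Real.Angle) = 0 := by
    rw [Complex.arg_div_coe_angle hx hy, smul_sub, h, sub_self]
  have h2 : Real.Angle.sin ((Complex.arg (x / y) : ℝ) : Real.Angle) = 0 := by
    rcases Real.Angle.two_zsmul_eq_zero_iff.1 h1 with h | h <;> rw [h] <;> simp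
  rw [Real.Angle.sin_coe, Complex.sin_arg, div_eq_zero_iff] at h2
  have h3 : (x / y).im = 0 := h2.resolve_right (by simp [hx, hy])
  have h4 := Complex.conj_eq_iff_im.2 h3
  rw [map_div₀, div_eq_div_iff (conj_ne_zero hy) hy] at h4
  exact h4.symm

theorem DirAngleEq.mul_conj_eq {A B C R R' : ℂ} (h : DirAngleEq B A R R' A C) :
    conj (B - A) * conj (C - A) * ((R - A) * (R' - A)) =
      (B - A) * (C - A) * (conj (R - A) * conj (R' - A)) := by
  unfold DirAngleEq at h
  rw [Complex.oangle, Complex.oangle] at h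
  have := mul_conj_eq_of_two_zsmul_arg_eq h
  simp only [map_mul, Complex.conj_conj] at this
  linear_combination this

/-- −τ is e^{2iθ} for the common directed angle θ from a side to the line joining its point to `P`.
The quotient giving τ is undefined at a point equal to `P`; since `x ≠ y`, one of these two can be
used. -/
theorem exists_common_ratio {p q r x y z P : ℂ} (hp : p * conj p = 1) (hq : q * conj q = 1)
    (hxy : x ≠ y)
    (h1 : (P - x) * (q * conj (P - y)) = (P - y) * (p * conj (P - x)))
    (h2 : (P - y) * (r * conj (P - z)) = (P - z) * (q * conj (P - y)))
    (h3 : (P - z) * (p * conj (P - x)) = (P - x) * (r * conj (P - z))) :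
    ∃ τ : ℂ, τ * conj τ = 1 ∧ P - x = τ * (p * conj (P - x)) ∧
      P - y = τ * (q * conj (P - y)) ∧ P - z = τ * (r * conj (P - z)) := by
  have key : ∀ {p u : ℂ}, p * conj p = 1 → u ≠ 0 →
      u / (p * conj u) * conj (u / (p * conj u)) = 1 := by
    intro p u hp hu
    have hp0 : p ≠ 0 := left_ne_zero_of_mul_eq_one hp
    have hu' := conj_ne_zero hu
    have hp' := conj_ne_zero hp0
    simp only [map_div₀, map_mul, Complex.conj_conj]
    field_simp
    exact hp.symm
  have hp0 : p ≠ 0 := left_ne_zero_of_mul_eq_one hp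
  have hq0 : q ≠ 0 := left_ne_zero_of_mul_eq_one hq
  by_cases hx : P - x = 0
  · have hy : P - y ≠ 0 := fun hy => hxy (by linear_combination hy - hx)
    have hv : q * conj (P - y) ≠ 0 := mul_ne_zero hq0 (conj_ne_zero hy)
    refine ⟨(P - y) / (q * conj (P - y)), key hq hy, by rw [hx]; simp, ?_, ?_⟩
    · rw [div_mul_cancel₀ _ hv]
    · rw [div_mul_eq_mul_div, eq_div_iff hv, h2]
  · have hv : p * conj (P - x) ≠ 0 := mul_ne_zero hp0 (conj_ne_zero hx)
    refine ⟨(P - x) / (p * conj (P - x)), key hp hx, ?_, ?_, ?_⟩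
    · rw [div_mul_cancel₀ _ hv]
    · rw [div_mul_eq_mul_div, eq_div_iff hv, h1]
    · rw [div_mul_eq_mul_div, eq_div_iff hv, h3]

/-! ### The ratios of the two Miquel points and the reflection coefficients -/

/-- The determinant with rows `(1, x, p)`, `(1, y, q)`, `(1, z, r)`, up to sign. -/
def areaForm (x y z p q r : ℂ) : ℂ := x * (q - r) + y * (r - p) + z * (p - q)

/-- The form is the determinant of the three side equations; it factors through the side AB and the
differences of directions. -/
theorem areaForm_ne_zero {A B s t u p q r : ℂ} (hAB : A ≠ B)
    (hqr : q ≠ r) (hrp : r ≠ p)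
    (hA : A + q * conj A = t) (hA' : A + r * conj A = u)
    (hB : B + r * conj B = u) (hB' : B + p * conj B = s) :
    areaForm s t u p q r ≠ 0 := by
  have h : (conj A - conj B) * ((q - r) * (r - p)) = areaForm s t u p q r := by
    unfold areaForm
    linear_combination (r - p) * (hA - hA') - (q - r) * (hB - hB')
  rw [← h]
  refine mul_ne_zero ?_ (mul_ne_zero (sub_ne_zero.2 hqr) (sub_ne_zero.2 hrp))
  rw [← map_sub]
  exact conj_ne_zero (sub_ne_zero.2 hAB)

/-- The form kills the constant column and the column (p, q, r), so only the multiple τ survives. -/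
theorem areaForm_eq_mul {P τ σ x y z x' y' z' p q r : ℂ}
    (h1 : P + τ * x' - σ * p = x) (h2 : P + τ * y' - σ * q = y)
    (h3 : P + τ * z' - σ * r = z) :
    areaForm x y z p q r = τ * areaForm x' y' z' p q r := by
  unfold areaForm
  linear_combination -(q - r) * h1 - (r - p) * h2 - (p - q) * h3

/-- The data of one vertex: the circle with diameter `AR` passes through the second common point
`X`, and so does the circle with diameter `OR`. -/
theorem exists_reflection_coeff {b₁ b₂ c₁ c₂ A X R τ : ℂ}
    (hb₁ : b₁ * conj b₁ = 1) (hb₂ : b₂ * conj b₂ = 1)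
    (hc₁ : c₁ * conj c₁ = 1) (hc₂ : c₂ * conj c₂ = 1)
    (hbc : b₁ * b₂ ≠ c₁ * c₂) (hb : b₁ ≠ b₂) (hτ : 1 - τ ≠ 0)
    (hRb : (R + b₁ * b₂ * conj R) * (1 - τ) = 2 * (b₁ - τ * b₂))
    (hRc : (R + c₁ * c₂ * conj R) * (1 - τ) = 2 * (c₁ - τ * c₂))
    (hAb : A + b₁ * b₂ * conj A = b₁ + b₂) (hAc : A + c₁ * c₂ * conj A = c₁ + c₂)
    (hX : (X - A) * (b₁ - c₁ - b₂ + c₂) = (b₁ - A) * (c₂ - A) - (b₂ - A) * (c₁ - A)) :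
    b₁ - c₁ - b₂ + c₂ ≠ 0 ∧ ∃ κ : ℂ, κ * conj κ = 1 ∧
      κ * (b₁ - c₁ - b₂ + c₂) = b₁ * b₂ * (c₂ - c₁) + c₁ * c₂ * (b₁ - b₂) ∧
      2 * X = R + κ * conj R ∧ R - A = -κ * conj (R - A) := by
  have hb₁0 : b₁ ≠ 0 := left_ne_zero_of_mul_eq_one hb₁
  have hb₂0 : b₂ ≠ 0 := left_ne_zero_of_mul_eq_one hb₂
  have hc₁0 : c₁ ≠ 0 := left_ne_zero_of_mul_eq_one hc₁
  have hc₂0 : c₂ ≠ 0 := left_ne_zero_of_mul_eq_one hc₂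
  have hcd : b₁ * b₂ * (c₂ - c₁) + c₁ * c₂ * (b₁ - b₂) =
      -(b₁ * b₂ * c₁ * c₂) * conj (b₁ - c₁ - b₂ + c₂) := by
    simp only [map_sub, map_add, eq_inv_of_mul_eq_one_right hb₁, eq_inv_of_mul_eq_one_right hb₂,
      eq_inv_of_mul_eq_one_right hc₁, eq_inv_of_mul_eq_one_right hc₂]
    field_simp
    ring
  -- If this vanished, so would its conjugate, and the two relations together force b₁ = b₂ or
  -- parallel sides.
  have hd : b₁ - c₁ - b₂ + c₂ ≠ 0 := by
    intro h0
    rw [h0, map_zero, mul_zero] at hcd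
    have : (b₁ - b₂) * (b₁ * b₂ - c₁ * c₂) = 0 := by
      linear_combination b₁ * b₂ * h0 - hcd
    exact mul_ne_zero (sub_ne_zero.2 hb) (sub_ne_zero.2 hbc) this
  have hd' := conj_ne_zero hd
  refine ⟨hd, -(b₁ * b₂ * c₁ * c₂) * conj (b₁ - c₁ - b₂ + c₂) / (b₁ - c₁ - b₂ + c₂), ?_⟩
  have hκ := div_mul_cancel₀ (-(b₁ * b₂ * c₁ * c₂) * conj (b₁ - c₁ - b₂ + c₂)) hd
  have hunit : -(b₁ * b₂ * c₁ * c₂) * conj (b₁ - c₁ - b₂ + c₂) / (b₁ - c₁ - b₂ + c₂) *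
      conj (-(b₁ * b₂ * c₁ * c₂) * conj (b₁ - c₁ - b₂ + c₂) / (b₁ - c₁ - b₂ + c₂)) = 1 := by
    rw [map_div₀, map_mul, Complex.conj_conj, div_mul_div_comm, div_eq_one_iff_eq
      (mul_ne_zero hd hd')]
    have : (b₁ * b₂ * c₁ * c₂) * conj (b₁ * b₂ * c₁ * c₂) = 1 := by
      simp only [map_mul]
      linear_combination hb₁ + b₁ * conj b₁ * hb₂ + b₁ * conj b₁ * b₂ * conj b₂ * hc₁ +
        b₁ * conj b₁ * b₂ * conj b₂ * c₁ * conj c₁ * hc₂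
    rw [map_neg]
    linear_combination (b₁ - c₁ - b₂ + c₂) * conj (b₁ - c₁ - b₂ + c₂) * this
  replace hκ := hκ.trans hcd.symm
  generalize -(b₁ * b₂ * c₁ * c₂) * conj (b₁ - c₁ - b₂ + c₂) / (b₁ - c₁ - b₂ + c₂) = κ at *
  refine ⟨hunit, hκ, ?_, ?_⟩
  · apply mul_right_cancel₀ hd
    apply mul_right_cancel₀ hτ
    -- Weighting `hRb` by c₂ − c₁ and `hRc` by b₁ − b₂ makes the right side 2(1 − τ)(b₁c₂ − b₂c₁).
    -- So τ cancels and the polar of A₀ remains.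
    linear_combination 2 * (1 - τ) * hX - conj R * (1 - τ) * hκ - (c₂ - c₁) * hRb -
      (b₁ - b₂) * hRc
  · rw [map_sub]
    apply mul_right_cancel₀ hd
    apply mul_right_cancel₀ hτ
    -- The same weights applied to the side equations of `A` show that `A` is on this polar as well.
    linear_combination (conj R - conj A) * (1 - τ) * hκ + (c₂ - c₁) * hRb +
      (b₁ - b₂) * hRc - (1 - τ) * ((c₂ - c₁) * hAb + (b₁ - b₂) * hAc)

/-- The polars of two of the three points on the Pascal line meet in at most one point. -/
theorem eq_of_reflection_coeff {a₁ a₂ b₁ b₂ c₁ c₂ κ μ R S : ℂ}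
    (hc : c₁ ≠ c₂)
    (hK : areaForm (a₁ - a₂) (b₁ - b₂) (c₁ - c₂) (a₁ * a₂) (b₁ * b₂) (c₁ * c₂) ≠ 0)
    (hκ : κ * (b₁ - c₁ - b₂ + c₂) = b₁ * b₂ * (c₂ - c₁) + c₁ * c₂ * (b₁ - b₂))
    (hμ : μ * (c₁ - a₁ - c₂ + a₂) = c₁ * c₂ * (a₂ - a₁) + a₁ * a₂ * (c₁ - c₂))
    (h1 : S + κ * conj S = R + κ * conj R) (h2 : S + μ * conj S = R + μ * conj R) : S = R := by
  by_contra hne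
  have hS : conj S - conj R ≠ 0 := by
    rw [← map_sub]; exact conj_ne_zero (sub_ne_zero.2 hne)
  have h3 : κ - μ = 0 := by
    apply (mul_eq_zero.1 (_ : (κ - μ) * (conj S - conj R) = 0)).resolve_right hS
    linear_combination h1 - h2
  refine mul_ne_zero (sub_ne_zero.2 hc) hK ?_
  unfold areaForm
  linear_combination (b₁ - c₁ - b₂ + c₂) * (c₁ - a₁ - c₂ + a₂) * h3 -
    (c₁ - a₁ - c₂ + a₂) * hκ + (b₁ - c₁ - b₂ + c₂) * hμ

/-- Multiplying the conjugate of R' − A by γ turns the direction of AR', isogonal to AR, into that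
of the chord pκ: both have quotient −pκ by their conjugates. -/
theorem isogonal_collinear {p q r A B C R R' κ γ : ℂ} (hp : p * conj p = 1)
    (hκ : κ * conj κ = 1)
    (hB : B - A ≠ 0) (hC : C - A ≠ 0) (hR : R - A ≠ 0)
    (hq : C - A = -q * conj (C - A)) (hr : B - A = -r * conj (B - A))
    (hγ : γ = p * q * r * conj γ)
    (hRA : R - A = -κ * conj (R - A))
    (h : conj (B - A) * conj (C - A) * ((R - A) * (R' - A)) =
      (B - A) * (C - A) * (conj (R - A) * conj (R' - A))) :
    (κ - p) * conj (γ * conj (R' - A)) = conj (κ - p) * (γ * conj (R' - A)) := by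
  have hR' := conj_ne_zero hR
  have h0 : conj (B - A) * conj (C - A) * conj (R - A) ≠ 0 :=
    mul_ne_zero (mul_ne_zero (conj_ne_zero hB) (conj_ne_zero hC)) hR'
  have h1 : κ * (R' - A) = -(q * r) * conj (R' - A) := by
    apply mul_left_cancel₀ h0
    generalize conj (R' - A) = x at *
    generalize R' - A = y at *
    generalize conj (R - A) = z at *
    generalize conj (B - A) = b at *
    generalize conj (C - A) = c at *
    rw [hRA, hq, hr] at h
    linear_combination -h
  have hκ0 : κ ≠ 0 := left_ne_zero_of_mul_eq_one hκ
  rw [map_mul, Complex.conj_conj, map_sub (starRingEnd ℂ) κ p]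
  generalize conj (R' - A) = x at *
  generalize R' - A = y at *
  generalize conj γ = δ at *
  rw [hγ]
  apply mul_left_cancel₀ hκ0
  linear_combination (κ - p) * δ * h1 - q * r * δ * x * (p * hκ - κ * hp)

/-! ### Concurrency of chords -/

/-- The pair (z : w) is a homogeneous common point of the three lines, at infinity if w = 0. The
kernel is stable under (v₀, v₁, v₂) ↦ (v̄₁, v̄₀, v̄₂). Adding to a kernel vector its image gives a
fixed vector; if that sum is zero, `I` times the vector is fixed. -/
theorem real_kernel {l m n l' m' n' : ℂ}
    (hl : l * conj l = 1) (hm : m * conj m = 1) (hn : n * conj n = 1)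
    (hl' : l * conj l' = l') (hm' : m * conj m' = m') (hn' : n * conj n' = n')
    (hdet : areaForm l' m' n' l m n = 0) :
    ∃ (z : ℂ) (w : ℝ), (z ≠ 0 ∨ w ≠ 0) ∧
      z + l * conj z = l' * w ∧ z + m * conj z = m' * w ∧ z + n * conj z = n' * w := by
  obtain ⟨v, hv, hMv⟩ := (Matrix.exists_mulVec_eq_zero_iff
    (M := !![1, l, -l'; 1, m, -m'; 1, n, -n'])).2 (by
      rw [Matrix.det_fin_three]
      unfold areaForm at hdet
      simp
      linear_combination hdet)
  have e1 := congrFun hMv 0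
  have e2 := congrFun hMv 1
  have e3 := congrFun hMv 2
  simp [Matrix.mulVec, dotProduct, Fin.sum_univ_three] at e1 e2 e3
  have conj_row : ∀ {l l' : ℂ}, l * conj l = 1 → l * conj l' = l' →
      v 0 + l * v 1 + -(l' * v 2) = 0 → conj (v 1) + l * conj (v 0) - l' * conj (v 2) = 0 := by
    intro l l' hl hl' h
    have := congrArg conj h
    simp only [map_add, map_neg, map_mul, map_zero] at this
    linear_combination l * this - conj (v 1) * hl + conj (v 2) * hl'
  have f1 := conj_row hl hl' e1
  have f2 := conj_row hm hm' e2
  have f3 := conj_row hn hn' e3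
  by_cases h : v 0 + conj (v 1) = 0 ∧ v 2 + conj (v 2) = 0
  · have h' := congrArg conj h.1
    simp only [map_add, Complex.conj_conj, map_zero] at h'
    obtain ⟨w, hw⟩ := (Complex.conj_eq_iff_real (z := Complex.I * v 2)).1 (by
      rw [map_mul, Complex.conj_I]; linear_combination -Complex.I * h.2)
    have g : ∀ {l l' : ℂ}, v 0 + l * v 1 + -(l' * v 2) = 0 →
        Complex.I * v 0 + l * conj (Complex.I * v 0) = l' * w := by
      intro l l' e
      rw [map_mul, Complex.conj_I, ← hw]
      linear_combination Complex.I * e - Complex.I * l * h'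
    refine ⟨Complex.I * v 0, w, ?_, g e1, g e2, g e3⟩
    by_contra hc
    push Not at hc
    obtain ⟨hc1, hc2⟩ := hc
    have h0 : v 0 = 0 := (mul_eq_zero.1 hc1).resolve_left Complex.I_ne_zero
    rw [hc2, Complex.ofReal_zero] at hw
    have h2 : v 2 = 0 := (mul_eq_zero.1 hw).resolve_left Complex.I_ne_zero
    rw [h0, map_zero, zero_add] at h'
    apply hv
    ext i
    fin_cases i
    · exact h0
    · exact h'
    · exact h2
  · obtain ⟨w, hw⟩ := (Complex.conj_eq_iff_real (z := v 2 + conj (v 2))).1 (by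
      rw [map_add, Complex.conj_conj]; ring)
    have g : ∀ {l l' : ℂ}, v 0 + l * v 1 + -(l' * v 2) = 0 →
        conj (v 1) + l * conj (v 0) - l' * conj (v 2) = 0 →
        v 0 + conj (v 1) + l * conj (v 0 + conj (v 1)) = l' * w := by
      intro l l' e f
      rw [map_add, Complex.conj_conj, ← hw]
      linear_combination e + f
    refine ⟨v 0 + conj (v 1), w, ?_, g e1 f1, g e2 f2, g e3 f3⟩
    by_contra hc
    push Not at hc
    refine h ⟨hc.1, ?_⟩
    rw [hw, hc.2, Complex.ofReal_zero]

/-- The chords of the unit circle from three points `p`, `q`, `r` of the circle, isogonal to the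
lines through `g` in the triangle `pqr`, are concurrent. -/
theorem isogonal_chords_det {p q r κ μ ν g : ℂ}
    (hp : p * conj p = 1) (hq : q * conj q = 1) (hr : r * conj r = 1)
    (hpq : p ≠ q) (hqr : q ≠ r) (hrp : r ≠ p)
    (hκ : κ * (g - p) = q * r * (1 - p * conj g)) (hμ : μ * (g - q) = r * p * (1 - q * conj g))
    (hν : ν * (g - r) = p * q * (1 - r * conj g)) :
    areaForm (p + κ) (q + μ) (r + ν) (p * κ) (q * μ) (r * ν) = 0 := by
  have vertex : ∀ {p q r μ : ℂ}, p * conj p = 1 → p ≠ q →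
      μ * (p - q) = r * p * (1 - q * conj p) → μ = r := by
    intro p q r μ hp hpq h
    apply mul_right_cancel₀ (sub_ne_zero.2 hpq)
    linear_combination h - r * q * hp
  have vertex' : ∀ {p q r μ : ℂ}, p * conj p = 1 → p ≠ q →
      μ * (p - q) = p * r * (1 - q * conj p) → μ = r := by
    intro p q r μ hp hpq h
    exact vertex hp hpq (by rw [h]; ring)
  -- At a vertex one coefficient is undetermined, but the other two chords both become the opposite
  -- side, so two rows agree.
  by_cases h1 : g = p
  · subst h1
    rw [vertex hp hpq hμ, vertex' hp hrp.symm hν]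
    unfold areaForm; ring
  by_cases h2 : g = q
  · subst h2
    rw [vertex' hq hpq.symm hκ, vertex hq hqr hν]
    unfold areaForm; ring
  by_cases h3 : g = r
  · subst h3
    rw [vertex hr hrp hκ, vertex' hr hqr.symm hμ]
    unfold areaForm; ring
  have h0 : (g - p) * (g - q) * (g - r) ≠ 0 :=
    mul_ne_zero (mul_ne_zero (sub_ne_zero.2 h1) (sub_ne_zero.2 h2)) (sub_ne_zero.2 h3)
  have hdet : areaForm (p + κ) (q + μ) (r + ν) (p * κ) (q * μ) (r * ν) *
      ((g - p) * (g - q) * (g - r)) =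
      (p * (g - p) + κ * (g - p)) *
        (q * (μ * (g - q)) * (g - r) - r * (ν * (g - r)) * (g - q)) +
      (q * (g - q) + μ * (g - q)) *
        (r * (ν * (g - r)) * (g - p) - p * (κ * (g - p)) * (g - r)) +
      (r * (g - r) + ν * (g - r)) *
        (p * (κ * (g - p)) * (g - q) - q * (μ * (g - q)) * (g - p)) := by
    unfold areaForm; ring
  apply (mul_eq_zero.1 (_ : _ * ((g - p) * (g - q) * (g - r)) = 0)).resolve_right h0
  rw [hdet, hκ, hμ, hν]
  ring

theorem arePerspective_of_chords {O ρ R p q r κ μ ν X Y Z X' Y' Z' : ℂ}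
    (hρ : ρ ≠ 0) (hR : R ≠ 0)
    (hp : p * conj p = 1) (hq : q * conj q = 1) (hr : r * conj r = 1)
    (hκ : κ * conj κ = 1) (hμ : μ * conj μ = 1) (hν : ν * conj ν = 1)
    (hX : 2 * X = R + p * conj R) (hY : 2 * Y = R + q * conj R) (hZ : 2 * Z = R + r * conj R)
    (hX' : 2 * X' = R + κ * conj R) (hY' : 2 * Y' = R + μ * conj R)
    (hZ' : 2 * Z' = R + ν * conj R)
    (hdet : areaForm (p + κ) (q + μ) (r + ν) (p * κ) (q * μ) (r * ν) = 0) :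
    ArePerspective (O + ρ * X) (O + ρ * Y) (O + ρ * Z) (O + ρ * X') (O + ρ * Y') (O + ρ * Z') := by
  have hmul : ∀ {p κ : ℂ}, p * conj p = 1 → κ * conj κ = 1 →
      p * κ * conj (p * κ) = 1 ∧ p * κ * conj (p + κ) = p + κ := by
    intro p κ hp hκ
    rw [map_mul, map_add]
    exact ⟨by linear_combination κ * conj κ * hp + hκ, by linear_combination κ * hp + p * hκ⟩
  obtain ⟨z, w, hzw, e1, e2, e3⟩ := real_kernel (hmul hp hκ).1 (hmul hq hμ).1 (hmul hr hν).1
    (hmul hp hκ).2 (hmul hq hμ).2 (hmul hr hν).2 hdet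
  have hRc : conj R ≠ 0 := conj_ne_zero hR
  by_cases hw : w = 0
  · right
    have hz : z ≠ 0 := hzw.resolve_right (not_not.2 hw)
    have key : ∀ {p κ X X' : ℂ}, p * conj p = 1 → κ * conj κ = 1 → 2 * X = R + p * conj R →
        2 * X' = R + κ * conj R → z + p * κ * conj z = (p + κ) * w →
        ∃ t : ℝ, (O + ρ * X') - (O + ρ * X) = t • (ρ * conj R * z) := by
      intro p κ X X' hp hκ hX hX' e
      rw [hw, Complex.ofReal_zero, mul_zero] at e
      have hpκ : p * κ ≠ 0 :=
        mul_ne_zero (left_ne_zero_of_mul_eq_one hp) (left_ne_zero_of_mul_eq_one hκ)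
      obtain ⟨t, ht⟩ := (Complex.conj_eq_iff_real (z := (κ - p) / (2 * z))).1 (by
        rw [map_div₀, div_eq_div_iff (conj_ne_zero (by simpa using hz)) (by simpa using hz),
          map_mul, map_sub, Complex.conj_ofNat]
        apply mul_left_cancel₀ hpκ
        linear_combination 2 * z * p * hκ - 2 * z * κ * hp - 2 * (κ - p) * e)
      rw [div_eq_iff (by simpa using hz)] at ht
      refine ⟨t, ?_⟩
      rw [Complex.real_smul]
      linear_combination ρ / 2 * (hX' - hX) + ρ * conj R / 2 * ht
    obtain ⟨t1, h1⟩ := key hp hκ hX hX' e1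
    obtain ⟨t2, h2⟩ := key hq hμ hY hY' e2
    obtain ⟨t3, h3⟩ := key hr hν hZ hZ' e3
    exact ⟨ρ * conj R * z, mul_ne_zero (mul_ne_zero hρ hRc) hz, t1, t2, t3, h1, h2, h3⟩
  · left
    have hw' : (w : ℂ) ≠ 0 := by exact_mod_cast hw
    have key : ∀ {p κ X X' : ℂ}, p * conj p = 1 → κ * conj κ = 1 → 2 * X = R + p * conj R →
        2 * X' = R + κ * conj R → z + p * κ * conj z = (p + κ) * w →
        Collinear ℝ {O + ρ * X, O + ρ * X', O + ρ * ((R + z / w * conj R) / 2)} := by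
      intro p κ X X' hp hκ hX hX' e
      have hpκ : p * κ ≠ 0 :=
        mul_ne_zero (left_ne_zero_of_mul_eq_one hp) (left_ne_zero_of_mul_eq_one hκ)
      obtain ⟨s, rfl⟩ : ∃ s : ℂ, z = s * w := ⟨z / w, (div_mul_cancel₀ _ hw').symm⟩
      rw [mul_div_cancel_right₀ _ hw']
      have e' : s + p * κ * conj s = p + κ := by
        apply mul_right_cancel₀ hw'
        rw [map_mul, Complex.conj_ofReal] at e
        linear_combination e
      apply collinear_of_mul_conj_eq
      have g1 : O + ρ * X' - (O + ρ * X) = ρ * conj R / 2 * (κ - p) := by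
        linear_combination ρ / 2 * (hX' - hX)
      have g2 : O + ρ * ((R + s * conj R) / 2) - (O + ρ * X) = ρ * conj R / 2 * (s - p) := by
        linear_combination - ρ / 2 * hX
      rw [g1, g2, map_mul, map_mul, map_sub, map_sub]
      apply mul_left_cancel₀ hpκ
      generalize conj (ρ * conj R / 2) = x
      linear_combination ρ * conj R / 2 * x * ((κ - p) * e' - κ * (κ - p) * hp -
        (s - p) * (p * hκ - κ * hp))
    exact ⟨_, key hp hκ hX hX' e1, key hq hμ hY hY' e2, key hr hν hZ hZ' e3⟩

/-! ### Passing to coordinates in which Γ is the unit circle -/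

theorem radius_ne_zero_of_mem {s : Sphere ℂ} {x y : ℂ} (hx : x ∈ s) (hy : y ∈ s) (hxy : x ≠ y) :
    (s.radius : ℂ) ≠ 0 := by
  intro h
  have h0 : s.radius = 0 := by exact_mod_cast h
  rw [mem_sphere, h0, dist_eq_zero] at hx hy
  exact hxy (hx.trans hy.symm)

theorem exists_scaled (O : ℂ) {ρ : ℂ} (hρ : ρ ≠ 0) (Z : ℂ) : ∃ z, Z = O + ρ * z :=
  ⟨(Z - O) / ρ, by field_simp; ring⟩

theorem exists_chord_equation {Γ : Sphere ℂ} (hr : (Γ.radius : ℂ) ≠ 0) {B C A₁ A₂ : ℂ}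
    (h : (Γ : Set ℂ) ∩ (line[ℝ, B, C] : Set ℂ) = {A₁, A₂}) (hne : A₁ ≠ A₂) :
    ∃ a₁ a₂ : ℂ, A₁ = Γ.center + Γ.radius * a₁ ∧ A₂ = Γ.center + Γ.radius * a₂ ∧
      a₁ * conj a₁ = 1 ∧ a₂ * conj a₂ = 1 ∧
      ∀ z : ℂ, Γ.center + Γ.radius * z ∈ line[ℝ, B, C] → z + a₁ * a₂ * conj z = a₁ + a₂ := by
  obtain ⟨a₁, rfl⟩ := exists_scaled Γ.center hr A₁
  obtain ⟨a₂, rfl⟩ := exists_scaled Γ.center hr A₂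
  have h₁ : Γ.center + Γ.radius * a₁ ∈ (Γ : Set ℂ) ∩ (line[ℝ, B, C] : Set ℂ) := by rw [h]; simp
  have h₂ : Γ.center + Γ.radius * a₂ ∈ (Γ : Set ℂ) ∩ (line[ℝ, B, C] : Set ℂ) := by rw [h]; simp
  have unit : ∀ {a : ℂ}, Γ.center + Γ.radius * a ∈ (Γ : Set ℂ) → a * conj a = 1 := by
    intro a ha
    have := normSq_of_mem (s := Γ) ha
    rw [add_sub_cancel_left, map_mul, Complex.conj_ofReal] at this
    apply mul_left_cancel₀ (mul_ne_zero hr hr)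
    linear_combination this
  have u₁ := unit h₁.1
  have u₂ := unit h₂.1
  refine ⟨a₁, a₂, rfl, rfl, u₁, u₂, fun z hz => ?_⟩
  obtain ⟨s, hs⟩ := (mem_line_iff _ _ _).1 h₁.2
  obtain ⟨t, ht⟩ := (mem_line_iff _ _ _).1 h₂.2
  obtain ⟨u, hu⟩ := (mem_line_iff _ _ _).1 hz
  have hts : (t : ℂ) - s ≠ 0 := by
    intro h0
    apply hne
    rw [hs, ht]
    linear_combination -(C - B) * h0
  have e₁ : Γ.radius * (a₂ - a₁) = (t - s) * (C - B) := by linear_combination ht - hs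
  have e₂ : Γ.radius * (z - a₁) = (u - s) * (C - B) := by linear_combination hu - hs
  have c₁ := congrArg conj e₁
  have c₂ := congrArg conj e₂
  simp only [map_mul, map_sub, Complex.conj_ofReal] at c₁ c₂
  apply mul_left_cancel₀ (mul_ne_zero hr hts)
  linear_combination (t - s) * (e₂ + a₁ * a₂ * c₂) - (u - s) * (e₁ + a₁ * a₂ * c₁) +
    Γ.radius * (u - s) * (a₁ * u₂ - a₂ * u₁) + Γ.radius * (t - s) * a₂ * u₁

theorem IsMiquelPoint.exists_ratio {A B C D E F M p q r : ℂ} (h : IsMiquelPoint A B C D E F M)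
    (hAB : A ≠ B) (hBC : B ≠ C) (hCA : C ≠ A) (hDE : D ≠ E)
    (hp : p * conj p = 1) (hq : q * conj q = 1)
    (hpd : C - B = -p * conj (C - B)) (hqd : A - C = -q * conj (A - C))
    (hrd : B - A = -r * conj (B - A)) :
    ∃ τ : ℂ, τ * conj τ = 1 ∧ M - D = τ * (p * conj (M - D)) ∧
      M - E = τ * (q * conj (M - E)) ∧ M - F = τ * (r * conj (M - F)) := by
  obtain ⟨s, t, u, hs, ht, hu, hMs, hMt, hMu⟩ := h
  have neg : ∀ {x y p : ℂ}, x - y = -p * conj (x - y) → y - x = -p * conj (y - x) := by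
    intro x y p h
    rw [map_sub] at h ⊢
    linear_combination -h
  refine exists_common_ratio hp hq hDE ?_ ?_ ?_
  · exact hu.angle_eq hMu (sub_ne_zero.2 hBC) (sub_ne_zero.2 hCA.symm) (neg hpd) hqd
  · exact hs.angle_eq hMs (sub_ne_zero.2 hCA) (sub_ne_zero.2 hAB.symm) (neg hqd) hrd
  · exact ht.angle_eq hMt (sub_ne_zero.2 hAB) (sub_ne_zero.2 hBC.symm) (neg hrd) hpd

theorem ratio_of_mem_line {P X T τ p : ℂ} (hT : T ∈ line[ℝ, P, X])
    (h : P - X = τ * (p * conj (P - X))) : T - X = τ * (p * conj (T - X)) := by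
  obtain ⟨t, rfl⟩ := (mem_line_iff _ _ _).1 hT
  simp only [map_sub, map_add, map_mul, Complex.conj_ofReal] at h ⊢
  linear_combination (1 - (t : ℂ)) * h

theorem unscale_ratio {O x y τ p ρ : ℂ} (hρ : ρ ≠ 0) (hρ' : conj ρ = ρ)
    (h : (O + ρ * x) - (O + ρ * y) = τ * (p * conj ((O + ρ * x) - (O + ρ * y)))) :
    x - y = τ * (p * conj (x - y)) := by
  rw [add_sub_add_left_eq_sub, ← mul_sub, map_mul, hρ'] at h
  apply mul_left_cancel₀ hρ
  linear_combination h

theorem scale_direction {O x y p s ρ : ℂ} (hρ' : conj ρ = ρ)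
    (hx : x + p * conj x = s) (hy : y + p * conj y = s) :
    (O + ρ * x) - (O + ρ * y) = -p * conj ((O + ρ * x) - (O + ρ * y)) := by
  rw [add_sub_add_left_eq_sub, ← mul_sub, map_mul, hρ', map_sub]
  linear_combination ρ * (hx - hy)

/-- The data of a triangle whose sides cut the unit circle in `a₁, a₂`, `b₁, b₂`, `c₁, c₂`, with
`τ` the common ratio of its inscribed triangle `a₁b₁c₁`. -/
theorem ratio_relations {a₁ a₂ b₁ b₂ c₁ c₂ P Q τ σ : ℂ}
    (ha₁ : a₁ * conj a₁ = 1) (ha₂ : a₂ * conj a₂ = 1) (hb₁ : b₁ * conj b₁ = 1)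
    (hb₂ : b₂ * conj b₂ = 1) (hc₁ : c₁ * conj c₁ = 1) (hc₂ : c₂ * conj c₂ = 1)
    (hN : areaForm (a₁ + a₂) (b₁ + b₂) (c₁ + c₂) (a₁ * a₂) (b₁ * b₂) (c₁ * c₂) ≠ 0)
    (pa : P - a₁ = τ * (a₁ * a₂ * conj (P - a₁))) (pb : P - b₁ = τ * (b₁ * b₂ * conj (P - b₁)))
    (pc : P - c₁ = τ * (c₁ * c₂ * conj (P - c₁))) (qa : Q - a₂ = σ * (a₁ * a₂ * conj (Q - a₂)))
    (qb : Q - b₂ = σ * (b₁ * b₂ * conj (Q - b₂))) (qc : Q - c₂ = σ * (c₁ * c₂ * conj (Q - c₂))) :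
    σ * τ = 1 ∧ 1 + τ ≠ 0 ∧ (1 - τ ≠ 0 →
      areaForm (a₁ - a₂) (b₁ - b₂) (c₁ - c₂) (a₁ * a₂) (b₁ * b₂) (c₁ * c₂) ≠ 0) := by
  rw [map_sub] at pa pb pc qa qb qc
  -- Since p ā₁ = a₂, `pa` reads a₁ = P + τa₂ − τP̄p.
  have hP : areaForm a₁ b₁ c₁ (a₁ * a₂) (b₁ * b₂) (c₁ * c₂) =
      τ * areaForm a₂ b₂ c₂ (a₁ * a₂) (b₁ * b₂) (c₁ * c₂) :=
    areaForm_eq_mul (P := P) (σ := τ * conj P)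
      (by linear_combination pa - τ * a₂ * ha₁) (by linear_combination pb - τ * b₂ * hb₁)
      (by linear_combination pc - τ * c₂ * hc₁)
  have hQ : areaForm a₂ b₂ c₂ (a₁ * a₂) (b₁ * b₂) (c₁ * c₂) =
      σ * areaForm a₁ b₁ c₁ (a₁ * a₂) (b₁ * b₂) (c₁ * c₂) :=
    areaForm_eq_mul (P := Q) (σ := σ * conj Q)
      (by linear_combination qa - σ * a₁ * ha₂) (by linear_combination qb - σ * b₁ * hb₂)
      (by linear_combination qc - σ * c₁ * hc₂)
  have hadd : areaForm (a₁ + a₂) (b₁ + b₂) (c₁ + c₂) (a₁ * a₂) (b₁ * b₂) (c₁ * c₂) =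
      areaForm a₁ b₁ c₁ (a₁ * a₂) (b₁ * b₂) (c₁ * c₂) +
        areaForm a₂ b₂ c₂ (a₁ * a₂) (b₁ * b₂) (c₁ * c₂) := by
    unfold areaForm; ring
  have hsub : areaForm (a₁ - a₂) (b₁ - b₂) (c₁ - c₂) (a₁ * a₂) (b₁ * b₂) (c₁ * c₂) =
      areaForm a₁ b₁ c₁ (a₁ * a₂) (b₁ * b₂) (c₁ * c₂) -
        areaForm a₂ b₂ c₂ (a₁ * a₂) (b₁ * b₂) (c₁ * c₂) := by
    unfold areaForm; ring
  rw [hadd] at hN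
  rw [hsub]
  generalize areaForm a₁ b₁ c₁ (a₁ * a₂) (b₁ * b₂) (c₁ * c₂) = U at *
  generalize areaForm a₂ b₂ c₂ (a₁ * a₂) (b₁ * b₂) (c₁ * c₂) = V at *
  have hV : V ≠ 0 := by
    rintro rfl
    exact hN (by rw [hP]; ring)
  refine ⟨?_, ?_, fun hτ h0 => ?_⟩
  · apply mul_right_cancel₀ hV
    linear_combination -hQ - σ * hP
  · intro h0
    exact hN (by linear_combination hP + V * h0)
  · exact mul_ne_zero hτ hV (by linear_combination hP - h0)

/-- For τ = 1 the lines PA₁ and QA₂ would be perpendicular to BC at different points, hence without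
a common point T. -/
theorem ratio_ne_one {a₁ a₂ T τ σ : ℂ} (h : a₁ ≠ a₂)
    (ha₁ : a₁ * conj a₁ = 1) (ha₂ : a₂ * conj a₂ = 1) (hστ : σ * τ = 1)
    (h₁ : T - a₁ = τ * (a₁ * a₂ * conj (T - a₁)))
    (h₂ : T - a₂ = σ * (a₁ * a₂ * conj (T - a₂))) : 1 - τ ≠ 0 := by
  intro h0
  obtain rfl : τ = 1 := by linear_combination -h0
  obtain rfl : σ = 1 := by linear_combination hστ
  apply h
  rw [map_sub] at h₁ h₂
  linear_combination (h₂ - h₁ + a₂ * ha₁ - a₁ * ha₂) / 2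

/-- The vertex `T` of the first Brocard triangle is the foot of the perpendicular from `R` to the
line through the centre orthogonal to the side. -/
theorem two_mul_brocard_vertex {a₁ a₂ P T τ σ R : ℂ}
    (ha₁ : a₁ * conj a₁ = 1) (ha₂ : a₂ * conj a₂ = 1) (hστ : σ * τ = 1)
    (hτ : 1 - τ ≠ 0) (hτ' : 1 + τ ≠ 0) (hR : R * (1 - τ) = 2 * P)
    (hRc : conj R * (1 - τ) = -2 * τ * conj P)
    (hP : P - a₁ = τ * (a₁ * a₂ * conj (P - a₁)))
    (h₁ : T - a₁ = τ * (a₁ * a₂ * conj (T - a₁)))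
    (h₂ : T - a₂ = σ * (a₁ * a₂ * conj (T - a₂))) :
    (R + a₁ * a₂ * conj R) * (1 - τ) = 2 * (a₁ - τ * a₂) ∧
      2 * T = R + a₁ * a₂ * conj R := by
  rw [map_sub] at hP h₁ h₂
  have e : (R + a₁ * a₂ * conj R) * (1 - τ) = 2 * (a₁ - τ * a₂) := by
    linear_combination hR + a₁ * a₂ * hRc + 2 * hP - 2 * τ * a₂ * ha₁
  refine ⟨e, ?_⟩
  apply mul_right_cancel₀ hτ
  rw [e]
  apply mul_right_cancel₀ hτ'
  linear_combination 2 * h₁ - 2 * τ ^ 2 * h₂ - 2 * τ * a₂ * ha₁ + 2 * τ * a₁ * ha₂ -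
    2 * τ * (a₁ * a₂ * (conj T - conj a₂)) * hστ

theorem IsSecondCommonPoint.scaled_eq {O ρ A B C b₁ b₂ c₁ c₂ X p q s t : ℂ}
    (hρ : ρ ≠ 0) (hρ' : conj ρ = ρ)
    (h : IsSecondCommonPoint (O + ρ * A) (O + ρ * B) (O + ρ * C) (O + ρ * b₁) (O + ρ * c₁)
      (O + ρ * b₂) (O + ρ * c₂) (O + ρ * X))
    (hCA : C ≠ A) (hAB : A ≠ B) (hC : C + p * conj C = s) (hA : A + p * conj A = s)
    (hA' : A + q * conj A = t) (hB : B + q * conj B = t) (hpq : p ≠ q) (hb : b₁ ≠ b₂) :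
    (X - A) * (b₁ - c₁ - b₂ + c₂) = (b₁ - A) * (c₂ - A) - (b₂ - A) * (c₁ - A) := by
  have hne : ∀ {x y : ℂ}, x ≠ y → O + ρ * x ≠ O + ρ * y := fun hxy h =>
    hxy (mul_left_cancel₀ hρ (add_left_cancel h))
  have e := h.eq (sub_ne_zero.2 (hne hCA)) (sub_ne_zero.2 (hne hAB.symm))
    (scale_direction hρ' hC hA) (scale_direction hρ' hB hA') hpq (hne hb)
  apply mul_left_cancel₀ (mul_ne_zero hρ hρ)
  linear_combination e

theorem isogonal_scaled_collinear {O ρ A B C p q r s t R R' κ γ T X : ℂ}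
    (hρ : ρ ≠ 0) (hρ' : conj ρ = ρ) (hp : p * conj p = 1) (hκ : κ * conj κ = 1)
    (hCA : C ≠ A) (hAB : A ≠ B) (hRne : R ≠ A)
    (hC : C + q * conj C = s) (hA : A + q * conj A = s)
    (hA' : A + r * conj A = t) (hB : B + r * conj B = t)
    (hγ : γ = p * q * r * conj γ) (hRA : R - A = -κ * conj (R - A))
    (hT : 2 * T = R + p * conj R) (hX : 2 * X = R + κ * conj R)
    (h : DirAngleEq (O + ρ * B) (O + ρ * A) (O + ρ * R) R' (O + ρ * A) (O + ρ * C)) :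
    Collinear ℝ {O + ρ * T, O + ρ * X,
      conj R * γ / 2 * conj (R' - (O + ρ * A)) + (O + ρ * T)} := by
  have hne : ∀ {x y : ℂ}, x ≠ y → O + ρ * x ≠ O + ρ * y := fun hxy h =>
    hxy (mul_left_cancel₀ hρ (add_left_cancel h))
  have e := isogonal_collinear hp hκ (sub_ne_zero.2 (hne hAB.symm)) (sub_ne_zero.2 (hne hCA))
    (sub_ne_zero.2 (hne hRne)) (scale_direction hρ' hC hA) (scale_direction hρ' hB hA') hγ
    (by rw [add_sub_add_left_eq_sub, ← mul_sub, map_mul, hρ']; linear_combination ρ * hRA)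
    h.mul_conj_eq
  apply collinear_of_mul_conj_eq
  have g1 : O + ρ * X - (O + ρ * T) = ρ * conj R / 2 * (κ - p) := by
    linear_combination ρ / 2 * (hX - hT)
  have g2 : conj R * γ / 2 * conj (R' - (O + ρ * A)) + (O + ρ * T) - (O + ρ * T) =
      conj R / 2 * (γ * conj (R' - (O + ρ * A))) := by ring
  rw [g1, g2]
  generalize γ * conj (R' - (O + ρ * A)) = V at e ⊢
  simp only [map_div₀, map_mul, hρ', Complex.conj_conj, Complex.conj_ofNat]
  linear_combination ρ * conj R / 2 * (R / 2) * e

/-- γ is the factor of the inverse similarity from ABC to pqr. Subtracting the equation of each side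
at its two ends and adding up cancels the unconjugated vertices, leaving the compatibility of the
two ratios. -/
theorem triangle_relations {A B C p q r s t u : ℂ} (hAB : A ≠ B)
    (hp : p * conj p = 1) (hq : q * conj q = 1)
    (hB₁ : B + p * conj B = s) (hC₁ : C + p * conj C = s)
    (hC₂ : C + q * conj C = t) (hA₂ : A + q * conj A = t)
    (hA₃ : A + r * conj A = u) (hB₃ : B + r * conj B = u) :
    ∃ γ : ℂ, γ = p * q * r * conj γ ∧ γ * conj (A - B) = p - q ∧ γ * conj (A - C) = p - r := by
  have hd := conj_ne_zero (sub_ne_zero.2 hAB)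
  have e := div_mul_cancel₀ (p - q) hd
  refine ⟨(p - q) / conj (A - B), ?_, e, ?_⟩
  · have h1 : A - B = -r * conj (A - B) := by rw [map_sub]; linear_combination hA₃ - hB₃
    rw [map_div₀, Complex.conj_conj, mul_div_assoc', div_eq_div_iff hd (sub_ne_zero.2 hAB),
      map_sub]
    linear_combination (p - q) * h1 - r * conj (A - B) * (q * hp - p * hq)
  · rw [div_mul_eq_mul_div, div_eq_iff hd, map_sub, map_sub]
    linear_combination hB₁ - hC₁ - hA₂ + hC₂ + hA₃ - hB₃

end GenBrocard

/-! ### Assembly of the theorem -/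

open GenBrocard ComplexConjugate in
theorem proposition4p3
    (A B C : ℂ) (hABC : AffineIndependent ℝ ![A, B, C])
    (Γ : EuclideanGeometry.Sphere ℂ)
    (A₁ A₂ B₁ B₂ C₁ C₂ : ℂ)
    -- the circle meets the side lines in three pairs of points
    (hA : (Γ : Set ℂ) ∩ (line[ℝ, B, C] : Set ℂ) = {A₁, A₂}) (hA12 : A₁ ≠ A₂)
    (hB : (Γ : Set ℂ) ∩ (line[ℝ, C, A] : Set ℂ) = {B₁, B₂}) (hB12 : B₁ ≠ B₂)
    (hC : (Γ : Set ℂ) ∩ (line[ℝ, A, B] : Set ℂ) = {C₁, C₂}) (hC12 : C₁ ≠ C₂)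
    -- the two inscribed triangles are nondegenerate
    (h₁ : AffineIndependent ℝ ![A₁, B₁, C₁])
    (h₂ : AffineIndependent ℝ ![A₂, B₂, C₂])
    -- their Miquel points
    (P Q : ℂ)
    (hP : GenBrocard.IsMiquelPoint A B C A₁ B₁ C₁ P)
    (hQ : GenBrocard.IsMiquelPoint A B C A₂ B₂ C₂ Q)
    -- the generalized first Brocard triangle
    (TA TB TC : ℂ)
    (hTA : (line[ℝ, P, A₁] : Set ℂ) ∩ (line[ℝ, Q, A₂] : Set ℂ) = {TA})
    (hTB : (line[ℝ, P, B₁] : Set ℂ) ∩ (line[ℝ, Q, B₂] : Set ℂ) = {TB})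
    (hTC : (line[ℝ, P, C₁] : Set ℂ) ∩ (line[ℝ, Q, C₂] : Set ℂ) = {TC})
    (hT : AffineIndependent ℝ ![TA, TB, TC])
    -- the generalized second Brocard triangle
    (A' B' C' : ℂ)
    (hA' : GenBrocard.IsSecondCommonPoint A B C B₁ C₁ B₂ C₂ A')
    (hB' : GenBrocard.IsSecondCommonPoint B C A C₁ A₁ C₂ A₂ B')
    (hC' : GenBrocard.IsSecondCommonPoint C A B A₁ B₁ A₂ B₂ C') :
    GenBrocard.ArePerspective TA TB TC A' B' C' ∧
    ∃ f : ℂ → ℂ, GenBrocard.IsInverseSimilarity f ∧ f A = TA ∧ f B = TB ∧ f C = TC ∧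
      ∀ R R' : ℂ, GenBrocard.IsPoleOfPascalLine Γ A₁ A₂ B₁ B₂ C₁ C₂ R →
        GenBrocard.IsIsogonalConjugate A B C R R' →
        GenBrocard.IsPerspector TA TB TC A' B' C' (f R') := by
  have hρ : (Γ.radius : ℂ) ≠ 0 := by
    have m₁ : A₁ ∈ (Γ : Set ℂ) ∩ (line[ℝ, B, C] : Set ℂ) := by rw [hA]; simp
    have m₂ : A₂ ∈ (Γ : Set ℂ) ∩ (line[ℝ, B, C] : Set ℂ) := by rw [hA]; simp
    exact radius_ne_zero_of_mem (s := Γ) m₁.1 m₂.1 hA12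
  have hρ' : conj (Γ.radius : ℂ) = Γ.radius := Complex.conj_ofReal _
  have mT : ∀ {X Y T : ℂ}, (line[ℝ, P, X] : Set ℂ) ∩ (line[ℝ, Q, Y] : Set ℂ) = {T} →
      T ∈ line[ℝ, P, X] ∧ T ∈ line[ℝ, Q, Y] := by
    intro X Y T h
    have : T ∈ (line[ℝ, P, X] : Set ℂ) ∩ (line[ℝ, Q, Y] : Set ℂ) := by rw [h]; simp
    exact this
  -- coordinates in which the circle is the unit circle
  obtain ⟨a₁, a₂, rfl, rfl, ua₁, ua₂, la⟩ := exists_chord_equation hρ hA hA12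
  obtain ⟨b₁, b₂, rfl, rfl, ub₁, ub₂, lb⟩ := exists_chord_equation hρ hB hB12
  obtain ⟨c₁, c₂, rfl, rfl, uc₁, uc₂, lc⟩ := exists_chord_equation hρ hC hC12
  obtain ⟨A, rfl⟩ := exists_scaled Γ.center hρ A
  obtain ⟨B, rfl⟩ := exists_scaled Γ.center hρ B
  obtain ⟨C, rfl⟩ := exists_scaled Γ.center hρ C
  obtain ⟨P, rfl⟩ := exists_scaled Γ.center hρ P
  obtain ⟨Q, rfl⟩ := exists_scaled Γ.center hρ Q
  obtain ⟨TA, rfl⟩ := exists_scaled Γ.center hρ TA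
  obtain ⟨TB, rfl⟩ := exists_scaled Γ.center hρ TB
  obtain ⟨TC, rfl⟩ := exists_scaled Γ.center hρ TC
  obtain ⟨A', rfl⟩ := exists_scaled Γ.center hρ A'
  obtain ⟨B', rfl⟩ := exists_scaled Γ.center hρ B'
  obtain ⟨C', rfl⟩ := exists_scaled Γ.center hρ C'
  have unscale : ∀ {x y : ℂ}, Γ.center + Γ.radius * x ≠ Γ.center + Γ.radius * y → x ≠ y :=
    fun h hxy => h (by rw [hxy])
  replace hA12 := unscale hA12
  replace hB12 := unscale hB12
  replace hC12 := unscale hC12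
  have lBa := la B (left_mem_affineSpan_pair _ _ _)
  have lCa := la C (right_mem_affineSpan_pair _ _ _)
  have lCb := lb C (left_mem_affineSpan_pair _ _ _)
  have lAb := lb A (right_mem_affineSpan_pair _ _ _)
  have lAc := lc A (left_mem_affineSpan_pair _ _ _)
  have lBc := lc B (right_mem_affineSpan_pair _ _ _)
  have hn : (B - A) * (conj C - conj A) ≠ (conj B - conj A) * (C - A) := by
    intro h
    apply mul_conj_ne_of_affineIndependent hABC
    simp only [add_sub_add_left_eq_sub, ← mul_sub, map_mul, map_sub, hρ']
    linear_combination (Γ.radius : ℂ) ^ 2 * h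
  have hAB : A ≠ B := by rintro rfl; exact hn (by ring)
  have hBC : B ≠ C := by rintro rfl; exact hn (by ring)
  have hCA : C ≠ A := by rintro rfl; exact hn (by ring)
  have hab : a₁ * a₂ ≠ b₁ * b₂ := by
    intro h
    rw [← h] at lAb lCb
    apply hn
    linear_combination (conj C - conj B) * (lCb - lAb) -
      (conj C - conj A) * (lCa - lBa)
  have hbc : b₁ * b₂ ≠ c₁ * c₂ := by
    intro h
    rw [← h] at lAc lBc
    apply hn
    linear_combination (conj C - conj A) * (lBc - lAc) -
      (conj B - conj A) * (lCb - lAb)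
  have hca : c₁ * c₂ ≠ a₁ * a₂ := by
    intro h
    rw [← h] at lBa lCa
    apply hn
    linear_combination (conj C - conj B) * (lBc - lAc) -
      (conj B - conj A) * (lCa - lBa)
  have unit_mul : ∀ {x y : ℂ}, x * conj x = 1 → y * conj y = 1 →
      x * y * conj (x * y) = 1 := by
    intro x y hx hy
    rw [map_mul]
    linear_combination y * conj y * hx + hy
  have ua := unit_mul ua₁ ua₂
  have ub := unit_mul ub₁ ub₂
  have uc := unit_mul uc₁ uc₂
  have scale : ∀ {x y : ℂ}, x ≠ y → Γ.center + Γ.radius * x ≠ Γ.center + Γ.radius * y :=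
    fun hxy h => hxy (mul_left_cancel₀ hρ (add_left_cancel h))
  have ne_of_indep : ∀ {x y z : ℂ}, AffineIndependent ℝ ![x, y, z] → x ≠ y := by
    intro x y z h hxy
    exact absurd (h.injective (a₁ := 0) (a₂ := 1) hxy) (by decide)
  obtain ⟨τ, uτ, Pa, Pb, Pc⟩ := hP.exists_ratio (scale hAB) (scale hBC) (scale hCA)
    (ne_of_indep h₁) ua ub (scale_direction hρ' lCa lBa) (scale_direction hρ' lAb lCb)
    (scale_direction hρ' lBc lAc)
  obtain ⟨σ, -, Qa, Qb, Qc⟩ := hQ.exists_ratio (scale hAB) (scale hBC) (scale hCA)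
    (ne_of_indep h₂) ua ub (scale_direction hρ' lCa lBa) (scale_direction hρ' lAb lCb)
    (scale_direction hρ' lBc lAc)
  have TPa := unscale_ratio hρ hρ' (ratio_of_mem_line (mT hTA).1 Pa)
  have TPb := unscale_ratio hρ hρ' (ratio_of_mem_line (mT hTB).1 Pb)
  have TPc := unscale_ratio hρ hρ' (ratio_of_mem_line (mT hTC).1 Pc)
  have TQa := unscale_ratio hρ hρ' (ratio_of_mem_line (mT hTA).2 Qa)
  have TQb := unscale_ratio hρ hρ' (ratio_of_mem_line (mT hTB).2 Qb)
  have TQc := unscale_ratio hρ hρ' (ratio_of_mem_line (mT hTC).2 Qc)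
  replace Pa := unscale_ratio hρ hρ' Pa
  replace Pb := unscale_ratio hρ hρ' Pb
  replace Pc := unscale_ratio hρ hρ' Pc
  obtain ⟨hστ, hτ', hK⟩ := ratio_relations ua₁ ua₂ ub₁ ub₂ uc₁ uc₂
    (areaForm_ne_zero hAB hbc hca lAb lAc lBc lBa) Pa Pb Pc
    (unscale_ratio hρ hρ' Qa) (unscale_ratio hρ hρ' Qb) (unscale_ratio hρ hρ' Qc)
  have hτ := ratio_ne_one hA12 ua₁ ua₂ hστ TPa TQa
  replace hK := hK hτ
  -- the antipode of the centre on the Brocard circle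
  obtain ⟨R, hR⟩ : ∃ R, R * (1 - τ) = 2 * P := ⟨2 * P / (1 - τ), div_mul_cancel₀ _ hτ⟩
  have hRc : conj R * (1 - τ) = -2 * τ * conj P := by
    have := congrArg conj hR
    simp only [map_mul, map_sub, map_one, Complex.conj_ofNat] at this
    linear_combination -τ * this - conj R * uτ
  obtain ⟨Ra, hTA⟩ := two_mul_brocard_vertex ua₁ ua₂ hστ hτ hτ' hR hRc Pa TPa TQa
  obtain ⟨Rb, hTB⟩ := two_mul_brocard_vertex ub₁ ub₂ hστ hτ hτ' hR hRc Pb TPb TQb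
  obtain ⟨Rc, hTC⟩ := two_mul_brocard_vertex uc₁ uc₂ hστ hτ hτ' hR hRc Pc TPc TQc
  -- Otherwise the circle with diameter OR shrinks to O, and so does the first Brocard triangle.
  have hR0 : R ≠ 0 := by
    rintro rfl
    apply ne_of_indep hT
    rw [map_zero] at hTA hTB
    linear_combination (Γ.radius : ℂ) / 2 * (hTA - hTB)
  obtain ⟨dA, κ, uκ, hκ, hXA, hRA⟩ := exists_reflection_coeff ub₁ ub₂ uc₁ uc₂ hbc hB12 hτ Rb Rc
    lAb lAc (hA'.scaled_eq hρ hρ' hCA hAB lCb lAb lAc lBc hbc hB12)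
  obtain ⟨dB, μ, uμ, hμ, hXB, hRB⟩ := exists_reflection_coeff uc₁ uc₂ ua₁ ua₂ hca hC12 hτ Rc Ra
    lBc lBa (hB'.scaled_eq hρ hρ' hAB hBC lAc lBc lBa lCa hca hC12)
  obtain ⟨-, ν, uν, hν, hXC, hRC⟩ := exists_reflection_coeff ua₁ ua₂ ub₁ ub₂ hab hA12 hτ Ra Rb
    lCa lCb (hC'.scaled_eq hρ hρ' hBC hCA lBa lCa lCb lAb hab hA12)
  obtain ⟨γ, hγ, hγB, hγC⟩ := triangle_relations hAB ua ub lBa lCa lCb lAb lAc lBc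
  rw [map_sub] at hγB hγC
  -- With `g` the image of `R` in the triangle pqr, the direction of the line from a vertex to `R`
  -- becomes the isogonality of the corresponding chord.
  have chord : ∀ {x p q r κ g : ℂ}, p * conj p = 1 → γ = p * q * r * conj γ →
      R - x = -κ * conj (R - x) → g = p + γ * conj (R - x) →
      κ * (g - p) = q * r * (1 - p * conj g) := by
    intro x p q r κ g hp hγ hx hg
    have hg' := congrArg conj hg
    rw [map_add, map_mul, Complex.conj_conj] at hg'
    rw [hg', hg]
    linear_combination κ * conj (R - x) * hγ + q * r * p * conj γ * hx + q * r * hp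
  refine ⟨arePerspective_of_chords hρ hR0 ua ub uc uκ uμ uν hTA hTB hTC hXA hXB hXC
    (isogonal_chords_det (g := a₁ * a₂ + γ * conj (R - A)) ua ub uc hab hbc hca
      (chord ua hγ hRA rfl) (chord ub (by linear_combination hγ) hRB ?_)
      (chord uc (by linear_combination hγ) hRC ?_)), ?_⟩
  · rw [map_sub, map_sub]; linear_combination -hγB
  · rw [map_sub, map_sub]; linear_combination -hγC
  have hγ0 : γ ≠ 0 := by
    rintro rfl
    exact hab (by linear_combination -hγB)
  -- The inverse similarity ABC → pqr followed by t ↦ (R + tR̄)/2, written with base point A.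
  refine ⟨fun z => conj R * γ / 2 * conj (z - (Γ.center + Γ.radius * A)) +
    (Γ.center + Γ.radius * TA), ⟨conj R * γ / 2,
      (Γ.center + Γ.radius * TA) - conj R * γ / 2 * conj (Γ.center + Γ.radius * A), ?_, ?_⟩,
    ?_, ?_, ?_, ?_⟩
  · exact div_ne_zero (mul_ne_zero (conj_ne_zero hR0) hγ0) two_ne_zero
  · intro z
    simp only [map_sub]; ring
  · simp
  · simp only [add_sub_add_left_eq_sub, ← mul_sub, map_mul, map_sub, hρ']
    linear_combination (Γ.radius : ℂ) / 2 * (hTA - hTB - conj R * hγB)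
  · simp only [add_sub_add_left_eq_sub, ← mul_sub, map_mul, map_sub, hρ']
    linear_combination (Γ.radius : ℂ) / 2 * (hTA - hTC - conj R * hγC)
  intro S S' hS hiso
  obtain ⟨S, rfl⟩ := exists_scaled Γ.center hρ S
  have hSR : S = R := by
    -- The polars of A₀ and B₀ already determine the pole.
    refine eq_of_reflection_coeff hC12 hK hκ hμ ?_ ?_
    · apply mul_right_cancel₀ (mul_ne_zero dA hτ)
      linear_combination (1 - τ) * hS.1.eq hρ ub₁ uc₂ uc₁ ub₂ +
        (1 - τ) * (conj S - conj R) * hκ - (c₂ - c₁) * Rb - (b₁ - b₂) * Rc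
    · apply mul_right_cancel₀ (mul_ne_zero dB hτ)
      linear_combination -(1 - τ) * hS.2.1.eq hρ ua₁ uc₂ uc₁ ua₂ +
        (1 - τ) * (conj S - conj R) * hμ - (a₂ - a₁) * Rc - (c₁ - c₂) * Ra
  subst hSR
  obtain ⟨nBC, nCA, nAB, iA, iB, iC⟩ := hiso
  have hSA : S ≠ A := by rintro rfl; exact nAB (left_mem_affineSpan_pair _ _ _)
  have hSB : S ≠ B := by rintro rfl; exact nAB (right_mem_affineSpan_pair _ _ _)
  have hSC : S ≠ C := by rintro rfl; exact nBC (right_mem_affineSpan_pair _ _ _)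
  refine ⟨isogonal_scaled_collinear hρ hρ' ua uκ hCA hAB hSA lCb lAb lAc lBc hγ hRA hTA hXA iA,
    ?_, ?_⟩
  -- The similarity is rewritten with base point B; `hγB` shows that it is the same map.
  · convert isogonal_scaled_collinear (γ := γ) hρ hρ' ub uμ hAB hBC hSB lAc lBc lBa lCa
      (by linear_combination hγ) hRB hTB hXB iB using 4
    simp only [map_sub, map_add, map_mul, hρ']
    linear_combination (Γ.radius : ℂ) / 2 * (hTA - hTB - conj S * hγB)
  · convert isogonal_scaled_collinear (γ := γ) hρ hρ' uc uν hBC hCA hSC lBa lCa lCb lAb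
      (by linear_combination hγ) hRC hTC hXC iC using 4
    simp only [map_sub, map_add, map_mul, hρ']
    linear_combination (Γ.radius : ℂ) / 2 * (hTA - hTC - conj S * hγC)
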